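/- Let $K\subseteq\mathbb R^2$ be a closed convex set (bounded or unbounded) with non-empty interior that is centrally symmetric, i.e. there is a point $c\in\mathbb R^2$ with $2c-K=K$. For $j=1,2$ let the $j$-th covering minimum be $$\mu_j(K)=\inf\{t\ge 0:\ \text{every }(2-j)\text{-dimensional affine subspace of }\mathbb R^2\text{ intersects } tK+\mathbb Z^2\}.$$ Then $$\mu_2(K)\le 2\,\mu_1(K).$$ Moreover, let the lattice width of $K$ be $w(K)=\min_{u\in\mathbb Z^2\setminus\{0\}} w(K,u)$, where $w(K,u)=\sup_{x\in K}\langle u,x\rangle-\inf_{x\in K}\langle u,x\rangle\in[0,\infty]$. If $K$ is lattice-free, i.e. the interior of $K$ contains no point of $\mathbb Z^2$, then $w(K)\le 2$. -/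

import Mathlib

open scoped Pointwise

noncomputable section

/-- The Euclidean plane. -/
abbrev Plane : Type := EuclideanSpace ℝ (Fin 2)

/-- The integer lattice `ℤ²`, as a subset of the plane. -/
def intLattice : Set Plane := {z | ∀ i, ∃ n : ℤ, z i = (n : ℝ)}

/-- `K` is centrally symmetric: it is invariant under the reflection `x ↦ 2c - x` in some
point `c`, not necessarily the origin. -/
def IsCentrallySymmetric (K : Set Plane) : Prop :=
  ∃ c : Plane, ∀ x ∈ K, (2 : ℝ) • c - x ∈ K

/-- `K` is lattice-free: no integer point lies in the interior of `K`. -/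
def IsLatticeFree (K : Set Plane) : Prop := Disjoint (interior K) intLattice

/-- The `j`-th covering minimum (`j = 1, 2`): the infimum of all `t ≥ 0` such that each
`(2 - j)`-dimensional affine subspace of the plane intersects `t K + ℤ²`. -/
def coveringMinimum (j : ℕ) (K : Set Plane) : ℝ :=
  sInf {t : ℝ | 0 ≤ t ∧ ∀ L : AffineSubspace ℝ Plane, (L : Set Plane).Nonempty →
    Module.finrank ℝ L.direction + j = 2 → ((L : Set Plane) ∩ (t • K + intLattice)).Nonempty}

/-- The support function `h(K, u) = sup {⟨u, x⟩ : x ∈ K}`, with value `⊤` if `⟨u, ·⟩` is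
unbounded above on `K`. -/
def supportFun (K : Set Plane) (u : Plane) : EReal :=
  ⨆ x ∈ K, ((inner ℝ u x : ℝ) : EReal)

/-- The width function `w(K, u) = h(K, u) + h(K, -u)`. -/
def widthFun (K : Set Plane) (u : Plane) : EReal := supportFun K u + supportFun K (-u)

/-- The lattice width: the least width of `K` in a non-zero integer direction. It is `⊤` if `K`
is unbounded in all these directions. -/
def latticeWidth (K : Set Plane) : EReal := ⨅ u ∈ intLattice \ {0}, widthFun K u

theorem inner_sub_le_widthFun (K : Set Plane) (u a b : Plane) (ha : a ∈ K) (hb : b ∈ K) :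
    ((inner ℝ u (a - b) : ℝ) : EReal) ≤ widthFun K u := by
  have h1 : ((inner ℝ u a : ℝ) : EReal) ≤ supportFun K u := le_iSup₂_of_le a ha le_rfl
  have h2 : ((inner ℝ (-u) b : ℝ) : EReal) ≤ supportFun K (-u) := le_iSup₂_of_le b hb le_rfl
  have := add_le_add h1 h2
  rw [← EReal.coe_add] at this
  rw [inner_sub_right, sub_eq_add_neg, ← inner_neg_left]
  exact this

theorem exists_mul_abs_le_widthFun (K : Set Plane) (hint : (interior K).Nonempty) :
    ∃ r > (0:ℝ), ∀ u : Plane, ∀ i, ((r * |u i| : ℝ) : EReal) ≤ widthFun K u := by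
  obtain ⟨c, hc⟩ := hint
  obtain ⟨e, he, hb⟩ := Metric.isOpen_iff.1 isOpen_interior c hc
  refine ⟨e/2, by positivity, fun u i => ?_⟩
  have hcK := interior_subset hc
  have key : ∀ s : ℝ, |s| = 1 → (((e/2) * (s * u i) : ℝ) : EReal) ≤ widthFun K u := by
    intro s hs
    have hmem : c + (e/2 * s) • EuclideanSpace.single i (1:ℝ) ∈ K := by
      apply interior_subset (hb _)
      rw [Metric.mem_ball, dist_eq_norm, add_sub_cancel_left, norm_smul]
      simp [hs, abs_of_pos he]
      exact he
    have := inner_sub_le_widthFun K u _ _ hmem hcK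
    rw [add_sub_cancel_left, inner_smul_right] at this
    simpa [EuclideanSpace.inner_single_right, mul_assoc] using this
  rcases abs_cases (u i) with ⟨h, _⟩ | ⟨h, _⟩
  · simpa [h] using key 1 (by simp)
  · simpa [h] using key (-1) (by simp)

/-- The minimum defining the lattice width is attained. -/
theorem exists_widthFun_eq_latticeWidth (K : Set Plane) (hint : (interior K).Nonempty) :
    ∃ u ∈ intLattice \ {0}, widthFun K u = latticeWidth K := by
  obtain ⟨r, hr, hw⟩ := exists_mul_abs_le_widthFun K hint
  by_cases htop : latticeWidth K = ⊤
  · refine ⟨EuclideanSpace.single 0 1, ⟨?_, ?_⟩, ?_⟩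
    · intro i; fin_cases i
      · exact ⟨1, by simp⟩
      · exact ⟨0, by simp⟩
    · simp
    · rw [htop, eq_top_iff, ← htop]
      refine iInf₂_le _ ⟨?_, by simp⟩
      intro i; fin_cases i
      · exact ⟨1, by simp⟩
      · exact ⟨0, by simp⟩
  obtain ⟨M, hM⟩ : ∃ M : ℝ, latticeWidth K < M := by
    obtain ⟨M, h1, _⟩ := EReal.lt_iff_exists_real_btwn.1 (lt_top_iff_ne_top.2 htop)
    exact ⟨M, h1⟩
  set S := {u | u ∈ intLattice \ {0} ∧ widthFun K u < M} with hS
  have hfin : S.Finite := by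
    apply Set.Finite.subset (s := (fun f : Fin 2 → ℤ => (WithLp.toLp 2 (fun i => (f i : ℝ)) : Plane)) ''
      (Set.Icc (fun _ => -⌈M / r⌉) (fun _ => ⌈M / r⌉))) ((Set.finite_Icc _ _).image _)
    rintro u ⟨⟨hu, _⟩, hlt⟩
    choose f hf using hu
    have hb : ∀ i, |f i| ≤ ⌈M / r⌉ := by
      intro i
      have := lt_of_le_of_lt (hw u i) hlt
      rw [EReal.coe_lt_coe_iff] at this
      have h2 : |u i| < M / r := by rw [lt_div_iff₀ hr]; linarith
      rw [hf] at h2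
      have h3 := h2.le.trans (Int.le_ceil _)
      rw [← Int.cast_abs] at h3
      exact Int.cast_le.1 h3
    refine ⟨f, ⟨fun i => (abs_le.1 (hb i)).1, fun i => (abs_le.1 (hb i)).2⟩, ?_⟩
    ext i; simp [hf]
  have hne : S.Nonempty := by
    rw [latticeWidth] at hM
    simp only [iInf_lt_iff] at hM
    obtain ⟨u, hu, h⟩ := hM
    exact ⟨u, hu, h⟩
  obtain ⟨u, hu, hmin⟩ := hfin.exists_minimalFor (widthFun K) S hne
  refine ⟨u, hu.1, le_antisymm (le_iInf₂ fun v hv => ?_) (iInf₂_le _ hu.1)⟩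
  by_cases h : widthFun K v < M
  · exact (le_total _ _).elim id (fun h' => hmin ⟨hv, h⟩ h')
  · exact hu.2.le.trans (not_lt.1 h)

end

/-! Both claims follow from `exists_intLattice_sub_mem_interior`: if `K` is symmetric about the
origin and its support function exceeds 1 on the non-zero integer vectors, the integer translates of
its interior cover the plane. For lattice-free `K` of width above 2, this would put an integer point
in the interior. For covering minima, if `t` is admissible for lines, then every dilate of `K` by
more than `2t`, recentred at the origin, satisfies the hypothesis.

For the covering itself, truncate `K` to a compact set and let `M > 1` be the least support value,
attained at a primitive `u`. In unimodular coordinates with `u` first, and after division by `M`,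
the body lies in `|x| ≤ 1`, touches that boundary at `(1, α)`, and has height at least 1 in every
direction `(n, 1)`. As `n` grows, the points reaching this height pass from `x ≤ 0` to `x ≥ 0`. At
the passage, a shear and a shrinking give points `(-β, 1)` and `(γ, 1 - γ)` with `β, γ ∈ [0, 1]`.
The symmetric hexagon they span with `(1, α)` covers by integer translates
(`intTranslatesCover_of_hexagon`), because its vertical sections, alone or stacked in pairs one unit
apart, have length at least 1. -/

/-! ### Covering by vertical sections -/

/-- A set in the plane whose integer translates cover the plane. -/
def IntTranslatesCover (Q : Set (ℝ × ℝ)) : Prop :=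
  ∀ x y : ℝ, ∃ m n : ℤ, (x - m, y - n) ∈ Q

/-- The point with abscissa `x` on the segment between two points of a convex set. -/
theorem Convex.exists_mem_of_abscissa {Q : Set (ℝ × ℝ)} (hQ : Convex ℝ Q) {x₁ y₁ x₂ y₂ x : ℝ}
    (h₁ : (x₁, y₁) ∈ Q) (h₂ : (x₂, y₂) ∈ Q) (hlt : x₁ < x₂) (hx₁ : x₁ ≤ x) (hx₂ : x ≤ x₂) :
    ∃ s, (x, s) ∈ Q ∧ s * (x₂ - x₁) = (x₂ - x) * y₁ + (x - x₁) * y₂ := by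
  have hd : 0 < x₂ - x₁ := sub_pos.2 hlt
  have hmem := hQ h₁ h₂ (a := (x₂ - x) / (x₂ - x₁)) (b := (x - x₁) / (x₂ - x₁))
    (div_nonneg (sub_nonneg.2 hx₂) hd.le) (div_nonneg (sub_nonneg.2 hx₁) hd.le)
    (by field_simp; ring)
  refine ⟨(x₂ - x) / (x₂ - x₁) * y₁ + (x - x₁) / (x₂ - x₁) * y₂, ?_, by field_simp⟩
  convert hmem using 1
  ext
  · simp only [Prod.smul_mk, Prod.mk_add_mk, smul_eq_mul]; field_simp; ring
  · simp

theorem Convex.mem_of_ordinate {Q : Set (ℝ × ℝ)} (hQ : Convex ℝ Q) {x y₁ y₂ y : ℝ}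
    (h₁ : (x, y₁) ∈ Q) (h₂ : (x, y₂) ∈ Q) (hy₁ : y₁ ≤ y) (hy₂ : y ≤ y₂) : (x, y) ∈ Q := by
  rcases (hy₁.trans hy₂).eq_or_lt with rfl | hlt
  · rwa [le_antisymm hy₂ hy₁]
  have hd : 0 < y₂ - y₁ := sub_pos.2 hlt
  have hmem := hQ h₁ h₂ (a := (y₂ - y) / (y₂ - y₁)) (b := (y - y₁) / (y₂ - y₁))
    (div_nonneg (sub_nonneg.2 hy₂) hd.le) (div_nonneg (sub_nonneg.2 hy₁) hd.le)
    (by field_simp; ring)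
  convert hmem using 1
  ext
  · simp only [Prod.smul_mk, Prod.mk_add_mk, smul_eq_mul]; field_simp; ring
  · simp only [Prod.smul_mk, Prod.mk_add_mk, smul_eq_mul]; field_simp; ring

theorem IntTranslatesCover.of_abscissa_le_half {Q : Set (ℝ × ℝ)} (hs : ∀ q ∈ Q, -q ∈ Q)
    (h : ∀ x y : ℝ, 0 ≤ x → x ≤ 1 / 2 → ∃ m n : ℤ, (x - m, y - n) ∈ Q) :
    IntTranslatesCover Q := by
  intro x y
  have hr := abs_le.1 (abs_sub_round x)
  rcases le_total 0 (x - round x) with h0 | h0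
  · obtain ⟨m, n, hmn⟩ := h _ y h0 hr.2
    refine ⟨round x + m, n, ?_⟩
    push_cast
    rwa [← sub_sub]
  · obtain ⟨m, n, hmn⟩ := h (-(x - round x)) (-y) (by linarith) (by linarith)
    refine ⟨round x - m, -n, ?_⟩
    convert hs _ hmn using 1
    ext <;> simp <;> ring

/-- A symmetric convex set whose vertical sections at `1 / 2` have length at least one. -/
theorem IntTranslatesCover.of_section_half {Q : Set (ℝ × ℝ)} (hQ : Convex ℝ Q)
    (hs : ∀ q ∈ Q, -q ∈ Q) {s₁ s₂ : ℝ} (h₁ : (1 / 2, s₁) ∈ Q) (h₂ : (-(1 / 2), s₂) ∈ Q)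
    (h : 1 ≤ s₁ + s₂) : IntTranslatesCover Q := by
  refine .of_abscissa_le_half hs fun x y hx₀ hx₁ => ?_
  -- Heights on a chord are affine, so `u + v = s₁ + s₂ ≥ 1`; by symmetry the section at `x`
  -- contains `[-v, u]`.
  obtain ⟨u, hu, hu'⟩ := hQ.exists_mem_of_abscissa (x := x) h₂ h₁ (by norm_num)
    (by linarith) hx₁
  obtain ⟨v, hv, hv'⟩ := hQ.exists_mem_of_abscissa (x := -x) h₂ h₁ (by norm_num)
    (by linarith) (by linarith)
  have hv2 : (x, -v) ∈ Q := by simpa using hs _ hv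
  refine ⟨0, ⌈y - u⌉, ?_⟩
  have hc₁ := Int.le_ceil (y - u)
  have hc₂ := Int.ceil_lt_add_one (y - u)
  simpa using hQ.mem_of_ordinate hv2 hu (by linarith) (by linarith)

/-! ### Hexagons -/

/-- The image of a set under the unimodular involution `(x, y) ↦ (-x, y + x)`. -/
def shearReflect (Q : Set (ℝ × ℝ)) : Set (ℝ × ℝ) := {q | (-q.1, q.2 + q.1) ∈ Q}

theorem mem_shearReflect {Q : Set (ℝ × ℝ)} {q : ℝ × ℝ} :
    q ∈ shearReflect Q ↔ (-q.1, q.2 + q.1) ∈ Q := Iff.rfl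

theorem Convex.shearReflect {Q : Set (ℝ × ℝ)} (hQ : Convex ℝ Q) : Convex ℝ (shearReflect Q) := by
  intro p hp q hq a b ha hb hab
  rw [mem_shearReflect] at *
  convert hQ hp hq ha hb hab using 1
  ext <;> simp <;> ring

theorem neg_mem_shearReflect {Q : Set (ℝ × ℝ)} (hs : ∀ q ∈ Q, -q ∈ Q) :
    ∀ q ∈ shearReflect Q, -q ∈ shearReflect Q := by
  intro q hq
  rw [mem_shearReflect] at *
  convert hs _ hq using 1
  ext <;> simp; ring

theorem IntTranslatesCover.of_shearReflect {Q : Set (ℝ × ℝ)}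
    (h : IntTranslatesCover (shearReflect Q)) : IntTranslatesCover Q := by
  intro x y
  obtain ⟨m, n, hmn⟩ := h (-x) (y + x)
  refine ⟨-m, m + n, ?_⟩
  rw [mem_shearReflect] at hmn
  convert hmn using 1
  ext <;> simp <;> ring

/-- For a convex set with points `(1, α)`, `(-β, 1)`, `(γ, 1 - γ)`, the upper boundary at `x` and
at `1 - x` has non-negative sum if `(x, ·)` is not in the part dominated by the last two points. -/
theorem Convex.exists_section_add_nonneg {Q : Set (ℝ × ℝ)} (hQ : Convex ℝ Q) {α β γ x : ℝ}
    (ha : (1, α) ∈ Q) (hb : (-β, 1) ∈ Q) (hc : (γ, 1 - γ) ∈ Q) (hα : -1 ≤ α) (hβ₀ : 0 ≤ β)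
    (hγ₀ : 0 ≤ γ) (hγ₁ : γ ≤ 1) (hx₁ : x ≤ 1 / 2) (hx : γ < x ∨ β < x) :
    ∃ s₁ s₂, (x, s₁) ∈ Q ∧ (1 - x, s₂) ∈ Q ∧ 0 ≤ s₁ + s₂ := by
  by_cases hγx : γ < x
  · obtain ⟨s, hs, hs'⟩ := hQ.exists_mem_of_abscissa (x := x) hc ha (by linarith) hγx.le
      (by linarith)
    obtain ⟨t, ht, ht'⟩ := hQ.exists_mem_of_abscissa (x := 1 - x) hc ha (by linarith)
      (by linarith) (by linarith)
    refine ⟨s, t, hs, ht, ?_⟩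
    -- `x` and `1 - x` are symmetric about `1 / 2`, so `s + t` is twice the chord's height there.
    have : 0 ≤ (s + t) * (1 - γ) := by nlinarith
    exact nonneg_of_mul_nonneg_left this (by linarith)
  have hβx : β < x := hx.resolve_left hγx
  rw [not_lt] at hγx
  obtain ⟨s, hs, hs'⟩ := hQ.exists_mem_of_abscissa (x := x) hb hc (by linarith) (by linarith) hγx
  rcases le_total γ (1 - x) with hγx' | hγx'
  · obtain ⟨t, ht, ht'⟩ := hQ.exists_mem_of_abscissa (x := 1 - x) hc ha (by linarith) hγx'
      (by linarith)
    refine ⟨s, t, hs, ht, ?_⟩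
    -- Both heights are compared with the line `y = 1 - 2x`, which is antisymmetric about `x = 1 /
    -- 2`.
    have h₁ : 1 - 2 * x ≤ s := by
      have : 0 ≤ (s - (1 - 2 * x)) * (γ + β) := by nlinarith
      linarith [nonneg_of_mul_nonneg_left this (by linarith)]
    have h₂ : 2 * x - 1 ≤ t := by
      have : 0 ≤ (t - (2 * x - 1)) * (1 - γ) := by nlinarith
      linarith [nonneg_of_mul_nonneg_left this (by linarith)]
    linarith
  · obtain ⟨t, ht, ht'⟩ := hQ.exists_mem_of_abscissa (x := 1 - x) hb hc (by linarith)
      (by linarith) hγx'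
    refine ⟨s, t, hs, ht, ?_⟩
    have h₁ : 0 ≤ s * (γ - -β) := by rw [hs']; nlinarith
    have h₂ : 0 ≤ t * (γ - -β) := by rw [ht']; nlinarith
    linarith [nonneg_of_mul_nonneg_left h₁ (by linarith),
      nonneg_of_mul_nonneg_left h₂ (by linarith)]

/-- If `x ≤ β` and `x ≤ γ`, the section at `x` alone has length at least 1. Otherwise the sections
at `x` and `x - 1` overlap, and their union has length at least 1; the second fact is the first one
applied to the sheared reflection, which swaps `β` and `γ`. -/
theorem intTranslatesCover_of_mem_Icc {Q : Set (ℝ × ℝ)} (hQ : Convex ℝ Q)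
    (hs : ∀ q ∈ Q, -q ∈ Q) {α β γ : ℝ} (ha : (1, α) ∈ Q) (hb : (-β, 1) ∈ Q)
    (hc : (γ, 1 - γ) ∈ Q) (hβ₀ : 0 ≤ β) (hβ₁ : β ≤ 1) (hγ₀ : 0 ≤ γ) (hγ₁ : γ ≤ 1)
    (hα₀ : -1 ≤ α) (hα₁ : α ≤ 0) : IntTranslatesCover Q := by
  refine .of_abscissa_le_half hs fun x y hx₀ hx₁ => ?_
  by_cases hx : γ < x ∨ β < x
  · obtain ⟨s₁, s₂, h₁, h₂, hsum⟩ :=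
      hQ.exists_section_add_nonneg ha hb hc hα₀ hβ₀ hγ₀ hγ₁ hx₁ hx
    obtain ⟨r₁, r₂, h₃, h₄, hsum'⟩ := hQ.shearReflect.exists_section_add_nonneg
      (α := -1 - α) (β := γ) (γ := β) (x := x)
      (by simpa [mem_shearReflect, sub_add_eq_add_sub] using hs _ ha)
      (by simpa [mem_shearReflect, sub_eq_add_neg] using hc)
      (by simpa [mem_shearReflect] using hb) (by linarith) hγ₀ hβ₀ hβ₁ hx₁ hx.symm
    rw [mem_shearReflect] at h₃ h₄
    have h₃' : (x, -(r₁ + x)) ∈ Q := by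
      convert hs _ h₃ using 1; ext <;> simp
    have h₄' : (x - 1, r₂ + (1 - x)) ∈ Q := by
      convert h₄ using 1; ext <;> simp
    have h₂' : (x - 1, -s₂) ∈ Q := by
      convert hs _ h₂ using 1; ext <;> simp
    have hc₁ := Int.floor_le (y + (r₁ + x))
    have hc₂ := Int.lt_floor_add_one (y + (r₁ + x))
    by_cases hy : y - ⌊y + (r₁ + x)⌋ ≤ s₁
    · exact ⟨0, ⌊y + (r₁ + x)⌋, by
        simpa using hQ.mem_of_ordinate h₃' h₁ (by linarith) hy⟩
    · exact ⟨1, ⌊y + (r₁ + x)⌋, by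
        simpa using hQ.mem_of_ordinate h₂' h₄' (by linarith) (by linarith)⟩
  · push Not at hx
    -- On the chord from `(-β, 1)` to `(γ, 1 - γ)`, `s + t` is twice the height at 0, that is `2 -
    -- 2βγ / (β + γ)`.
    obtain ⟨s, t, hs₁, ht₁, hst⟩ : ∃ s t, (x, s) ∈ Q ∧ (-x, t) ∈ Q ∧ 1 ≤ s + t := by
      rcases (add_nonneg hβ₀ hγ₀).eq_or_lt with h0 | h0
      · have hβ : β = 0 := by linarith
        have hγ : γ = 0 := by linarith
        have hx' : x = 0 := by linarith [hx.1]
        subst hβ hγ hx'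
        exact ⟨1, 1, by simpa using hb, by simpa using hb, by norm_num⟩
      obtain ⟨s, hs₁, hs'⟩ := hQ.exists_mem_of_abscissa (x := x) hb hc (by linarith)
        (by linarith) hx.1
      obtain ⟨t, ht₁, ht'⟩ := hQ.exists_mem_of_abscissa (x := -x) hb hc (by linarith)
        (by linarith) (by linarith)
      refine ⟨s, t, hs₁, ht₁, ?_⟩
      have : 0 ≤ (s + t - 1) * (γ + β) := by nlinarith
      linarith [nonneg_of_mul_nonneg_left this (by linarith)]
    have ht₂ : (x, -t) ∈ Q := by simpa using hs _ ht₁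
    refine ⟨0, ⌈y - s⌉, ?_⟩
    have hc₁ := Int.le_ceil (y - s)
    have hc₂ := Int.ceil_lt_add_one (y - s)
    simpa using hQ.mem_of_ordinate ht₂ hs₁ (by linarith) (by linarith)

/-- The hexagon is so steep that its sections at `±1 / 2` already have length at least 1; the cases
record which edges lie over these abscissas. -/
theorem intTranslatesCover_of_le_neg_one {Q : Set (ℝ × ℝ)} (hQ : Convex ℝ Q)
    (hs : ∀ q ∈ Q, -q ∈ Q) {α β γ : ℝ} (ha : (1, α) ∈ Q) (hb : (-β, 1) ∈ Q)
    (hc : (γ, 1 - γ) ∈ Q) (hβ₀ : 0 ≤ β) (hβ₁ : β ≤ 1) (hγ₀ : 0 ≤ γ) (hγ₁ : γ ≤ 1)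
    (hα : α ≤ -1) : IntTranslatesCover Q := by
  have ha' : (-1, -α) ∈ Q := by simpa using hs _ ha
  rcases le_or_gt γ (1 / 2) with hγ | hγ
  · obtain ⟨s, hs₁, hs'⟩ := hQ.exists_mem_of_abscissa (x := 1 / 2) hc ha (by linarith) hγ
      (by linarith)
    obtain ⟨t, ht₁, ht'⟩ := hQ.exists_mem_of_abscissa (x := -(1 / 2)) ha' hc (by linarith)
      (by linarith) (by linarith)
    refine .of_section_half hQ hs hs₁ ht₁ ?_
    have hs2 : s = (1 - 1 / 2) + (1 / 2 - γ) * α / (1 - γ) := by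
      have : 1 - γ ≠ 0 := by linarith
      field_simp
      linarith
    have ht2 : t = ((1 / 2) * (1 - γ) + (γ + 1 / 2) * (-α)) / (1 + γ) := by
      have : 1 + γ ≠ 0 := by linarith
      field_simp
      linarith
    have h1 : 0 < 1 - γ := by linarith
    have h2 : 0 < 1 + γ := by linarith
    have : s + t - 1 = γ * (γ - 1 - α) / ((1 - γ) * (1 + γ)) := by
      rw [hs2, ht2]; field_simp; ring
    have : 0 ≤ s + t - 1 := by
      rw [this]
      exact div_nonneg (mul_nonneg hγ₀ (by linarith)) (by positivity)
    linarith
  obtain ⟨s, hs₁, hs'⟩ := hQ.exists_mem_of_abscissa (x := 1 / 2) hb hc (by linarith)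
    (by linarith) hγ.le
  rcases le_or_gt (1 / 2) β with hβ | hβ
  · obtain ⟨t, ht₁, ht'⟩ := hQ.exists_mem_of_abscissa (x := -(1 / 2)) hb hc (by linarith)
      (by linarith) (by linarith)
    refine .of_section_half hQ hs hs₁ ht₁ ?_
    have : 0 ≤ (s + t - 1) * (γ + β) := by nlinarith
    linarith [nonneg_of_mul_nonneg_left this (by linarith)]
  · obtain ⟨t, ht₁, ht'⟩ := hQ.exists_mem_of_abscissa (x := -(1 / 2)) ha' hb (by linarith)
      (by linarith) (by linarith)
    refine .of_section_half hQ hs hs₁ ht₁ ?_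
    have h₁ : 0 ≤ s * (γ - -β) := by rw [hs']; nlinarith
    have h₁' := nonneg_of_mul_nonneg_left h₁ (by linarith)
    have h₂ : 0 ≤ (t - 1) * (1 - β) := by nlinarith
    linarith [nonneg_of_mul_nonneg_left h₂ (by linarith)]

/-- The integer translates of the hexagon with vertices `±(1, α)`, `±(-β, 1)`, `±(γ, 1 - γ)`
cover the plane. -/
theorem intTranslatesCover_of_hexagon {Q : Set (ℝ × ℝ)} (hQ : Convex ℝ Q)
    (hs : ∀ q ∈ Q, -q ∈ Q) {α β γ : ℝ} (ha : (1, α) ∈ Q) (hb : (-β, 1) ∈ Q)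
    (hc : (γ, 1 - γ) ∈ Q) (hβ₀ : 0 ≤ β) (hβ₁ : β ≤ 1) (hγ₀ : 0 ≤ γ) (hγ₁ : γ ≤ 1) :
    IntTranslatesCover Q := by
  rcases le_total α (-1) with h | h
  · exact intTranslatesCover_of_le_neg_one hQ hs ha hb hc hβ₀ hβ₁ hγ₀ hγ₁ h
  rcases le_total α 0 with h' | h'
  · exact intTranslatesCover_of_mem_Icc hQ hs ha hb hc hβ₀ hβ₁ hγ₀ hγ₁ h h'
  refine .of_shearReflect (intTranslatesCover_of_le_neg_one hQ.shearReflect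
    (neg_mem_shearReflect hs) (α := -1 - α) (β := γ) (γ := β) ?_ ?_ ?_ hγ₀ hγ₁ hβ₀ hβ₁
    (by linarith))
  · simpa [mem_shearReflect, sub_add_eq_add_sub] using hs _ ha
  · simpa [mem_shearReflect, sub_eq_add_neg] using hc
  · simpa [mem_shearReflect] using hb

/-! ### From the strip to a hexagon -/

/-- A symmetric convex set in the strip `|x| ≤ 1`, touching its boundary, covers the plane by
integer translates if it reaches height one in all directions `(n, 1)`. -/
theorem intTranslatesCover_of_strip {Q : Set (ℝ × ℝ)} (hQ : Convex ℝ Q)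
    (hs : ∀ q ∈ Q, -q ∈ Q) (hstrip : ∀ q ∈ Q, |q.1| ≤ 1) {α : ℝ} (ha : (1, α) ∈ Q)
    (hn : ∀ n : ℤ, ∃ q ∈ Q, 1 ≤ q.2 + n * q.1) : IntTranslatesCover Q := by
  have ha' : (-1, -α) ∈ Q := by simpa using hs _ ha
  have h0 : (0, 0) ∈ Q := by
    have := hQ ha ha' (a := 1 / 2) (b := 1 / 2) (by norm_num) (by norm_num) (by norm_num)
    convert this using 1
    ext <;> simp
  set P : ℤ → Prop := fun n => ∃ q ∈ Q, 1 ≤ q.2 + n * q.1 ∧ q.1 ≤ 0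
  -- Discrete sign change: `(-1, -α)` witnesses `P n` for very negative `n`, while `(1, α)` has
  -- height at least 1 for large `n`.
  obtain ⟨n, ⟨p, hp, hp₁, hp₀⟩, q, hq, hq₁, hq₀⟩ :
      ∃ n : ℤ, P n ∧ ∃ q ∈ Q, 1 ≤ q.2 + (n + 1 : ℤ) * q.1 ∧ 0 ≤ q.1 := by
    by_contra hcon
    push Not at hcon
    have hstep : ∀ n : ℤ, P n → P (n + 1) := by
      intro n hPn
      obtain ⟨q, hq, hq₁⟩ := hn (n + 1)
      exact ⟨q, hq, hq₁, (hcon n hPn q hq hq₁).le⟩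
    have hstart : P (⌊-1 - α⌋) := by
      refine ⟨_, ha', ?_, by norm_num⟩
      have := Int.floor_le (-1 - α)
      simp only
      linarith
    have hall : ∀ k : ℕ, P (⌊-1 - α⌋ + k) := by
      intro k
      induction k with
      | zero => simpa using hstart
      | succ k ih => simpa [add_assoc] using hstep _ ih
    have := hcon _ (hall 3) _ ha (by
      have := Int.lt_floor_add_one (-1 - α)
      push_cast
      linarith)
    norm_num at this
  have hshrink : ∀ v ∈ Q, ∀ H : ℝ, 1 ≤ H → H⁻¹ • v ∈ Q := by
    intro v hv H hH
    have h1 : H⁻¹ ≤ 1 := inv_le_one_of_one_le₀ hH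
    have := hQ hv h0 (a := H⁻¹) (b := 1 - H⁻¹) (by positivity) (by linarith) (by ring)
    convert this using 1
    ext <;> simp
  -- shear so that the direction `(n, 1)` becomes vertical
  set R : Set (ℝ × ℝ) := {v | (v.1, v.2 - n * v.1) ∈ Q}
  have hmem : ∀ v, v ∈ R ↔ (v.1, v.2 - n * v.1) ∈ Q := fun v => Iff.rfl
  have hRc : Convex ℝ R := by
    intro v hv w hw a b hva hwb hab
    rw [hmem] at *
    convert hQ hv hw hva hwb hab using 1
    ext <;> simp; ring
  have hRs : ∀ v ∈ R, -v ∈ R := by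
    intro v hv
    rw [hmem] at *
    convert hs _ hv using 1
    ext <;> simp; ring
  have hpos : ∀ H : ℝ, 1 ≤ H → 0 < H := fun H h => by linarith
  set H := p.2 + n * p.1 with hH
  set H' := q.2 + (n + 1 : ℤ) * q.1 with hH'
  have hH0 := hpos H hp₁
  have hH0' := hpos H' hq₁
  have hp2 := abs_le.1 (hstrip p hp)
  have hq2 := abs_le.1 (hstrip q hq)
  have hcov : IntTranslatesCover R := by
    refine intTranslatesCover_of_hexagon hRc hRs (α := α + n) (β := -p.1 / H) (γ := q.1 / H')
      ?_ ?_ ?_ (div_nonneg (by linarith) hH0.le) ?_ (div_nonneg hq₀ hH0'.le) ?_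
    · simpa [hmem] using ha
    · have := hshrink p hp H hp₁
      rw [hmem]
      convert this using 1
      ext
      · simp [div_eq_inv_mul]
      · simp only [Prod.smul_snd, smul_eq_mul]; field_simp; rw [hH]; ring
    · have := hshrink q hq H' hq₁
      rw [hmem]
      convert this using 1
      ext
      · simp [div_eq_inv_mul]
      · simp only [Prod.smul_snd, smul_eq_mul]; field_simp; rw [hH']; push_cast; ring
    · rw [div_le_one hH0]; linarith
    · rw [div_le_one hH0']; linarith
  intro x y
  obtain ⟨k, l, hkl⟩ := hcov x (y + n * x)
  refine ⟨k, l - n * k, ?_⟩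
  rw [hmem] at hkl
  convert hkl using 1
  ext <;> simp; ring


/-! ### Support functions on integer vectors and reduction to the strip -/

theorem Plane.inner_eq (u x : Plane) : inner ℝ u x = u 0 * x 0 + u 1 * x 1 := by
  simp [PiLp.inner_apply, Fin.sum_univ_two, mul_comm]

theorem exists_int_inner_eq {u z : Plane} (hu : u ∈ intLattice) (hz : z ∈ intLattice) :
    ∃ n : ℤ, inner ℝ u z = (n : ℝ) := by
  obtain ⟨a, ha⟩ := hu 0
  obtain ⟨b, hb⟩ := hu 1
  obtain ⟨c, hc⟩ := hz 0
  obtain ⟨d, hd⟩ := hz 1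
  exact ⟨a * c + b * d, by rw [Plane.inner_eq, ha, hb, hc, hd]; push_cast; ring⟩

theorem finite_intLattice_inter_abs_le (N : ℝ) :
    {u : Plane | u ∈ intLattice ∧ ∀ i, |u i| ≤ N}.Finite := by
  apply Set.Finite.subset (s := (fun f : Fin 2 → ℤ => (WithLp.toLp 2 (fun i => (f i : ℝ)) : Plane)) ''
    (Set.Icc (fun _ => -⌈N⌉) (fun _ => ⌈N⌉))) ((Set.finite_Icc _ _).image _)
  rintro u ⟨hu, hN⟩
  choose f hf using hu
  have hb : ∀ i, |f i| ≤ ⌈N⌉ := by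
    intro i
    have h := (hN i).trans (Int.le_ceil N)
    rw [hf, ← Int.cast_abs] at h
    exact Int.cast_le.1 h
  refine ⟨f, ⟨fun i => (abs_le.1 (hb i)).1, fun i => (abs_le.1 (hb i)).2⟩, ?_⟩
  ext i; simp [hf]

/-- A symmetric closed convex set whose support function exceeds one on non-zero integer vectors
can be truncated to a compact set with the same property. -/
theorem exists_compact_subset_one_lt_inner {K : Set Plane} (hclosed : IsClosed K)
    (hconv : Convex ℝ K) (hs : ∀ x ∈ K, -x ∈ K) (h0 : (0 : Plane) ∈ interior K)
    (hw : ∀ u ∈ intLattice \ {0}, ∃ k ∈ K, 1 < (inner ℝ u k : ℝ)) :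
    ∃ C ⊆ K, IsCompact C ∧ Convex ℝ C ∧ (∀ x ∈ C, -x ∈ C) ∧ (0 : Plane) ∈ interior C ∧
      ∀ u ∈ intLattice \ {0}, ∃ k ∈ C, 1 < (inner ℝ u k : ℝ) := by
  obtain ⟨e, he, hb⟩ := Metric.isOpen_iff.1 isOpen_interior _ h0
  -- Outside this finite set the ball of radius `e` in `K` already gives a support value above 1, so
  -- only the witnesses for `F` constrain the truncation radius.
  set F := {u : Plane | u ∈ intLattice ∧ ∀ i, |u i| ≤ 2 / e} with hF
  have hfin : F.Finite := finite_intLattice_inter_abs_le _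
  choose! k hkK hk using hw
  obtain ⟨R, hR⟩ := (hfin.image (fun u => ‖k u‖)).bddAbove
  refine ⟨K ∩ Metric.closedBall 0 (max R e), Set.inter_subset_left,
    (isCompact_closedBall _ _).inter_left hclosed, hconv.inter (convex_closedBall _ _), ?_, ?_, ?_⟩
  · rintro x ⟨hx, hx'⟩
    exact ⟨hs x hx, by simpa using hx'⟩
  · rw [interior_inter]
    refine ⟨h0, Metric.ball_subset_interior_closedBall ?_⟩
    simp [he]
  · intro u hu
    by_cases huF : u ∈ F
    · refine ⟨k u, ⟨hkK u hu, ?_⟩, hk u hu⟩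
      rw [mem_closedBall_zero_iff]
      exact (hR ⟨u, huF, rfl⟩).trans (le_max_left _ _)
    · obtain ⟨i, hi⟩ : ∃ i, 2 / e < |u i| := by
        by_contra hcon
        push Not at hcon
        exact huF ⟨hu.1, hcon⟩
      rw [div_lt_iff₀ he] at hi
      have hball : ∀ s : ℝ, |s| = 1 → s * u i = |u i| →
          ∃ k ∈ K ∩ Metric.closedBall 0 (max R e), 1 < (inner ℝ u k : ℝ) := by
        intro s hs hsu
        have hnorm : ‖(e / 2 * s) • EuclideanSpace.single i (1 : ℝ)‖ = e / 2 := by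
          rw [norm_smul]; simp [hs, abs_of_pos he]
        refine ⟨(e / 2 * s) • EuclideanSpace.single i (1 : ℝ), ⟨interior_subset (hb ?_), ?_⟩, ?_⟩
        · rw [mem_ball_zero_iff, hnorm]; linarith
        · rw [mem_closedBall_zero_iff, hnorm]
          exact le_trans (by linarith) (le_max_right _ _)
        · rw [inner_smul_right, EuclideanSpace.inner_single_right]
          simp only [one_mul, conj_trivial]
          rw [mul_assoc, hsu]
          linarith
      rcases abs_cases (u i) with ⟨h, _⟩ | ⟨h, _⟩
      · exact hball 1 (by simp) (by rw [h, one_mul])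
      · exact hball (-1) (by simp) (by rw [h, neg_one_mul])

/-- The support function of a symmetric compact body attains its minimum over the non-zero integer
vectors. -/
theorem exists_minimal_inner {C : Set Plane} (hC : IsCompact C) (hs : ∀ x ∈ C, -x ∈ C)
    (h0 : (0 : Plane) ∈ interior C) :
    ∃ u ∈ intLattice \ {0}, ∃ k ∈ C, (∀ x ∈ C, (inner ℝ u x : ℝ) ≤ inner ℝ u k) ∧
      ∀ v ∈ intLattice \ {0}, ∃ x ∈ C, (inner ℝ u k : ℝ) ≤ inner ℝ v x := by
  have hne : C.Nonempty := ⟨0, interior_subset h0⟩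
  have hmax : ∀ v : Plane, ∃ k ∈ C, ∀ x ∈ C, (inner ℝ v x : ℝ) ≤ inner ℝ v k := by
    intro v
    obtain ⟨k, hk, hk'⟩ := hC.exists_isMaxOn (f := fun x => (inner ℝ v x : ℝ)) hne (by fun_prop)
    exact ⟨k, hk, fun x hx => hk' hx⟩
  obtain ⟨u, hu, huw⟩ := exists_widthFun_eq_latticeWidth C ⟨0, h0⟩
  obtain ⟨k, hk, hku⟩ := hmax u
  refine ⟨u, hu, k, hk, hku, fun v hv => ?_⟩
  obtain ⟨x, hx, hxv⟩ := hmax v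
  refine ⟨x, hx, ?_⟩
  have h₁ := inner_sub_le_widthFun C u k (-k) hk (hs k hk)
  have h₂ : widthFun C v ≤ ((inner ℝ v x + inner ℝ v x : ℝ) : EReal) := by
    rw [EReal.coe_add]
    refine add_le_add (iSup₂_le fun y hy => ?_) (iSup₂_le fun y hy => ?_)
    · exact_mod_cast hxv y hy
    · rw [inner_neg_left, ← inner_neg_right]
      exact_mod_cast hxv _ (hs y hy)
  have h₃ : latticeWidth C ≤ widthFun C v := iInf₂_le v hv
  have h₄ := h₁.trans (huw.le.trans (h₃.trans h₂))
  rw [EReal.coe_le_coe_iff, sub_neg_eq_add, inner_add_right] at h₄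
  linarith

/-- An integer vector minimizing a positive support function among the non-zero ones is
primitive. -/
theorem exists_bezout_of_minimal {C : Set Plane} {u : Plane} {M : ℝ} (hM : 0 < M)
    (hu : u ∈ intLattice \ {0}) (hle : ∀ x ∈ C, (inner ℝ u x : ℝ) ≤ M)
    (hmin : ∀ v ∈ intLattice \ {0}, ∃ x ∈ C, M ≤ (inner ℝ v x : ℝ)) :
    ∃ a b c d : ℤ, u 0 = a ∧ u 1 = b ∧ a * d - b * c = 1 := by
  obtain ⟨a, ha⟩ := hu.1 0
  obtain ⟨b, hb⟩ := hu.1 1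
  have hne : 0 < Int.gcd a b := by
    rw [Int.gcd_pos_iff]
    by_contra hcon
    push Not at hcon
    refine hu.2 (Set.mem_singleton_iff.2 ?_)
    ext i
    fin_cases i
    · simp [ha, hcon.1]
    · simp [hb, hcon.2]
  obtain ⟨a', b', hcop, ha', hb'⟩ := Int.exists_gcd_one hne
  set g := Int.gcd a b with hg
  have hgR : (0 : ℝ) < g := by exact_mod_cast hne
  have huv : u = (g : ℝ) • (!₂[(a' : ℝ), (b' : ℝ)] : Plane) := by
    ext i
    fin_cases i
    · simp only [Fin.zero_eta, PiLp.smul_apply, smul_eq_mul, ha]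
      rw [ha']; simp [mul_comm]
    · simp only [Fin.mk_one, PiLp.smul_apply, smul_eq_mul, hb]
      rw [hb']; simp [mul_comm]
  obtain ⟨x, hx, hxM⟩ := hmin !₂[(a' : ℝ), (b' : ℝ)] ⟨by
    intro i
    fin_cases i
    · exact ⟨a', by simp⟩
    · exact ⟨b', by simp⟩, by
    intro h
    rw [Set.mem_singleton_iff] at h
    exact hu.2 (by rw [huv, h]; simp)⟩
  -- Dividing `u` by the gcd `g` divides its support value by `g`, so minimality forces `g = 1`.
  have h₁ := hle x hx
  rw [huv, inner_smul_left, conj_trivial] at h₁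
  have h₂ : (g : ℝ) ≤ 1 := by
    by_contra hcon
    push Not at hcon
    nlinarith
  have hg1 : g = 1 := le_antisymm (by exact_mod_cast h₂) hne
  obtain ⟨s, t, hst⟩ := Int.isCoprime_iff_gcd_eq_one.2 (hg.symm.trans hg1)
  exact ⟨a, b, -t, s, ha, hb, by linarith⟩

/-- If the support function of a symmetric closed convex set exceeds one on the non-zero integer
vectors, then the integer translates of its interior cover the plane. -/
theorem exists_intLattice_sub_mem_interior {K : Set Plane} (hclosed : IsClosed K)
    (hconv : Convex ℝ K) (hs : ∀ x ∈ K, -x ∈ K) (h0 : (0 : Plane) ∈ interior K)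
    (hw : ∀ u ∈ intLattice \ {0}, ∃ k ∈ K, 1 < (inner ℝ u k : ℝ)) (p : Plane) :
    ∃ z ∈ intLattice, p - z ∈ interior K := by
  obtain ⟨C, hCK, hC, hCc, hCs, hC0, hCw⟩ :=
    exists_compact_subset_one_lt_inner hclosed hconv hs h0 hw
  obtain ⟨u, hu, k, hk, hku, hmin⟩ := exists_minimal_inner hC hCs hC0
  set M : ℝ := inner ℝ u k with hMdef
  have hM : 1 < M := by
    obtain ⟨x, hx, hx'⟩ := hCw u hu
    exact hx'.trans_le (hku x hx)
  have hM0 : 0 < M := by linarith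
  obtain ⟨a, b, c, d, ha, hb, hdet⟩ := exists_bezout_of_minimal hM0 hu hku hmin
  have hdet' : (a * d - b * c : ℝ) = 1 := by exact_mod_cast hdet
  -- the body in the coordinates `(a x + b y, c x + d y) / M`
  set φ : ℝ × ℝ → Plane := fun q => M • !₂[d * q.1 - b * q.2, -c * q.1 + a * q.2] with hφ
  have hφ_of : ∀ x : Plane,
      φ (M⁻¹ * (a * x 0 + b * x 1), M⁻¹ * (c * x 0 + d * x 1)) = x := by
    intro x
    ext i
    fin_cases i
    · simp [hφ]; field_simp; linear_combination x 0 * hdet'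
    · simp [hφ]; field_simp; linear_combination x 1 * hdet'
  have hφ_inner : ∀ q, inner ℝ u (φ q) = M * q.1 := by
    intro q
    rw [Plane.inner_eq, ha, hb]
    simp [hφ]
    linear_combination M * q.1 * hdet'
  have hmem : ∀ q, q ∈ φ ⁻¹' C ↔ φ q ∈ C := fun q => Iff.rfl
  have hcover : IntTranslatesCover (φ ⁻¹' C) := by
    refine intTranslatesCover_of_strip (α := M⁻¹ * (c * k 0 + d * k 1)) ?_ ?_ ?_ ?_ ?_
    · intro q hq r hr s t hs ht hst
      rw [hmem] at *
      convert hCc hq hr hs ht hst using 1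
      ext i
      fin_cases i <;> simp [hφ] <;> ring
    · intro q hq
      rw [hmem] at *
      convert hCs _ hq using 1
      ext i
      fin_cases i <;> simp [hφ] <;> ring
    · intro q hq
      have h₁ := hku _ hq
      have h₂ := hku _ (hCs _ hq)
      rw [inner_neg_right] at h₂
      rw [hφ_inner] at h₁ h₂
      rw [abs_le]
      constructor <;> nlinarith
    · have : M⁻¹ * (a * k 0 + b * k 1) = 1 := by
        rw [← ha, ← hb, ← Plane.inner_eq]
        exact inv_mul_cancel₀ hM0.ne'
      rw [hmem, ← this, hφ_of]
      exact hk
    · intro n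
      obtain ⟨x, hx, hxM⟩ := hmin !₂[(c + n * a : ℝ), (d + n * b : ℝ)] ⟨by
        intro i
        fin_cases i
        · exact ⟨c + n * a, by simp⟩
        · exact ⟨d + n * b, by simp⟩, by
        intro h
        rw [Set.mem_singleton_iff] at h
        have h₀ := congrArg (fun v : Plane => v 0) h
        have h₁ := congrArg (fun v : Plane => v 1) h
        simp at h₀ h₁
        have : (a * (d + n * b) - b * (c + n * a) : ℝ) = 1 := by linear_combination hdet'
        rw [h₀, h₁] at this
        norm_num at this⟩
      refine ⟨(M⁻¹ * (a * x 0 + b * x 1), M⁻¹ * (c * x 0 + d * x 1)), ?_, ?_⟩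
      · rw [hmem, hφ_of]; exact hx
      · rw [Plane.inner_eq] at hxM
        simp at hxM
        have : M⁻¹ * M ≤ M⁻¹ * ((c + n * a) * x 0 + (d + n * b) * x 1) :=
          mul_le_mul_of_nonneg_left hxM (by positivity)
        rw [inv_mul_cancel₀ hM0.ne'] at this
        linarith
  obtain ⟨m, n, hmn⟩ := hcover (a * p 0 + b * p 1) (c * p 0 + d * p 1)
  refine ⟨!₂[(d * m - b * n : ℝ), (-c * m + a * n : ℝ)], ?_, ?_⟩
  · intro i
    fin_cases i
    · exact ⟨d * m - b * n, by simp⟩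
    · exact ⟨-c * m + a * n, by simp⟩
  -- `M > 1` gives the interior: `M⁻¹ • C` lies in the interior of `K` because 0 does.
  · have hM1 : M⁻¹ < 1 := inv_lt_one_of_one_lt₀ hM
    have := hconv.combo_self_interior_mem_interior (hCK hmn) h0 (a := M⁻¹) (b := 1 - M⁻¹)
      (by positivity) (by linarith) (by ring)
    convert this using 1
    rw [smul_zero, add_zero, hφ, inv_smul_smul₀ hM0.ne']
    ext i
    fin_cases i
    · simp; linear_combination (-p 0) * hdet'
    · simp; linear_combination (-p 1) * hdet'

/-! ### Covering minima and lattice width -/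

theorem center_mem_interior {K : Set Plane} (hconv : Convex ℝ K) (hint : (interior K).Nonempty)
    {c : Plane} (hc : ∀ x ∈ K, (2 : ℝ) • c - x ∈ K) : c ∈ interior K := by
  obtain ⟨x, hx⟩ := hint
  have := hconv.combo_interior_self_mem_interior hx (hc x (interior_subset hx)) (a := 1 / 2)
    (b := 1 / 2) (by norm_num) (by norm_num) (by norm_num)
  convert this using 1
  module

/-- The set of scaling factors whose infimum is the covering minimum contains each `t > 0` for
which the scaled centered body has support function above one on non-zero integer vectors. -/
theorem inter_smul_add_intLattice_nonempty {K : Set Plane} (hclosed : IsClosed K)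
    (hconv : Convex ℝ K) (hint : (interior K).Nonempty) {c : Plane}
    (hc : ∀ x ∈ K, (2 : ℝ) • c - x ∈ K) {t : ℝ} (ht : 0 < t)
    (hw : ∀ u ∈ intLattice \ {0}, ∃ k ∈ K, 1 < t * (inner ℝ u (k - c) : ℝ))
    {S : Set Plane} (hS : S.Nonempty) : (S ∩ (t • K + intLattice)).Nonempty := by
  obtain ⟨p, hp⟩ := hS
  set f : Plane → Plane := fun x => t⁻¹ • x + c with hf
  have hfc : Continuous f := by fun_prop
  have hmem : ∀ x, x ∈ f ⁻¹' K ↔ t⁻¹ • x + c ∈ K := fun x => Iff.rfl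
  obtain ⟨z, hz, hpz⟩ := exists_intLattice_sub_mem_interior (K := f ⁻¹' K)
    (hclosed.preimage hfc)
    (by
      intro x hx y hy a b ha hb hab
      rw [hmem] at *
      convert hconv hx hy ha hb hab using 1
      have : c = (a + b) • c := by rw [hab, one_smul]
      nth_rewrite 1 [this]
      module)
    (by
      intro x hx
      rw [hmem] at *
      convert hc _ hx using 1
      module)
    (by
      refine preimage_interior_subset_interior_preimage hfc ?_
      simpa [hf] using center_mem_interior hconv hint hc)
    (by
      intro u hu
      obtain ⟨k, hk, hk'⟩ := hw u hu
      refine ⟨t • (k - c), ?_, by rwa [inner_smul_right]⟩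
      rw [hmem, inv_smul_smul₀ ht.ne', sub_add_cancel]
      exact hk) (p - t • c)
  refine ⟨p, hp, t • (t⁻¹ • (p - t • c - z) + c), ⟨_, (hmem _).1 (interior_subset hpz), rfl⟩, z, hz, ?_⟩
  simp only [smul_add, smul_inv_smul₀ ht.ne']
  abel

theorem coveringMinimum_two_le {K : Set Plane} (hclosed : IsClosed K) (hconv : Convex ℝ K)
    (hint : (interior K).Nonempty) (hsymm : IsCentrallySymmetric K) :
    coveringMinimum 2 K ≤ 2 * coveringMinimum 1 K := by
  obtain ⟨c, hc⟩ := hsymm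
  have hcint := center_mem_interior hconv hint hc
  have hmain : ∀ t : ℝ, 0 ≤ t → (∀ L : AffineSubspace ℝ Plane, (L : Set Plane).Nonempty →
      Module.finrank ℝ L.direction + 1 = 2 → ((L : Set Plane) ∩ (t • K + intLattice)).Nonempty) →
      coveringMinimum 2 K ≤ 2 * t := by
    intro t ht0 ht
    -- The slack `ε` makes the factor positive even when `t = 0` and the support inequality strict.
    refine le_of_forall_pos_le_add fun ε hε => csInf_le ⟨0, fun s hs => hs.1⟩
      ⟨by positivity, fun L hL _ => ?_⟩
    refine inter_smul_add_intLattice_nonempty hclosed hconv hint hc (by positivity)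
      (fun u hu => ?_) hL
    by_contra! hcon
    have hu0 : u ≠ 0 := hu.2
    have hun : ‖u‖ ^ 2 ≠ 0 := by simpa using hu0
    -- The line `⟨u, x⟩ = τ` has level halfway between consecutive levels `t⟨u, c⟩ + n`, so `t • K`
    -- must extend at least `1 / 2` from its centre in direction `u` or `-u`.
    set τ : ℝ := t * inner ℝ u c + 1 / 2 with hτ
    have : Fact (Module.finrank ℝ Plane = 1 + 1) := ⟨by simp⟩
    obtain ⟨x, hxL, y, ⟨k, hk, rfl⟩, z, hz, hxz⟩ :=
      ht (AffineSubspace.mk' ((τ / ‖u‖ ^ 2) • u) (Submodule.span ℝ {u})ᗮ)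
        (AffineSubspace.mk'_nonempty _ _) (by
          rw [AffineSubspace.direction_mk', Submodule.finrank_orthogonal_span_singleton (n := 1) hu0])
    have hxu : inner ℝ u x = τ := by
      have h := Submodule.mem_orthogonal_singleton_iff_inner_right.1
        (AffineSubspace.mem_mk'.1 hxL)
      rw [vsub_eq_sub, inner_sub_right, inner_smul_right, real_inner_self_eq_norm_sq,
        div_mul_cancel₀ _ hun] at h
      linarith
    obtain ⟨n, hn⟩ := exists_int_inner_eq hu.1 hz
    simp only at hxz
    rw [← hxz, inner_add_right, inner_smul_right, hn] at hxu
    have h₁ := hcon k hk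
    have h₂ := hcon _ (hc k hk)
    rw [two_smul, add_sub_assoc, add_sub_cancel_left] at h₂
    rw [inner_sub_right] at h₁ h₂
    set δ : ℝ := inner ℝ u k - inner ℝ u c with hδ
    have hδ' : t * δ = 1 / 2 - n := by rw [hδ, mul_sub]; linarith
    have h₂' : (2 * t + ε) * (-δ) ≤ 1 := by rw [hδ, neg_sub]; exact h₂
    rcases le_or_gt n 0 with h | h
    · have hn0 : (n : ℝ) ≤ 0 := by exact_mod_cast h
      have hδ0 : 0 < δ := by
        by_contra! hneg
        nlinarith
      nlinarith
    · have hn0 : (1 : ℝ) ≤ n := by exact_mod_cast h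
      have hδ0 : δ < 0 := by
        by_contra! hneg
        nlinarith
      nlinarith
  -- The set defining `coveringMinimum 1 K` must be non-empty, since `sInf ∅ = 0` would not bound
  -- anything.
  have hne : ∃ t : ℝ, 0 < t ∧ ∀ u ∈ intLattice \ {0}, ∃ k ∈ K,
      1 < t * (inner ℝ u (k - c) : ℝ) := by
    obtain ⟨e, he, hb⟩ := Metric.isOpen_iff.1 isOpen_interior _ hcint
    refine ⟨4 / e, by positivity, fun u hu => ?_⟩
    have hu0 : u ≠ 0 := hu.2
    have hun : 0 < ‖u‖ := norm_pos_iff.2 hu0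
    have hu1 : 1 ≤ ‖u‖ := by
      obtain ⟨n, hn⟩ := exists_int_inner_eq hu.1 hu.1
      rw [real_inner_self_eq_norm_sq] at hn
      have h₁ : (0 : ℝ) < n := by rw [← hn]; positivity
      have h₂ : (1 : ℝ) ≤ n := by exact_mod_cast Int.cast_pos.1 h₁
      nlinarith
    refine ⟨c + (e / (2 * ‖u‖)) • u, interior_subset (hb ?_), ?_⟩
    · rw [Metric.mem_ball, dist_eq_norm, add_sub_cancel_left, norm_smul, Real.norm_eq_abs,
        abs_of_pos (by positivity)]
      have : e / (2 * ‖u‖) * ‖u‖ = e / 2 := by field_simp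
      rw [this]
      linarith
    · rw [add_sub_cancel_left, inner_smul_right, real_inner_self_eq_norm_sq]
      have : 4 / e * (e / (2 * ‖u‖) * ‖u‖ ^ 2) = 2 * ‖u‖ := by field_simp; norm_num
      rw [this]
      linarith
  obtain ⟨t, ht, hw⟩ := hne
  have h : coveringMinimum 2 K / 2 ≤ coveringMinimum 1 K :=
    le_csInf ⟨t, ht.le, fun L hL _ =>
      inter_smul_add_intLattice_nonempty hclosed hconv hint hc ht hw hL⟩
      fun s hs => by linarith [hmain s hs.1 hs.2]
  linarith

theorem latticeWidth_le_two {K : Set Plane} (hclosed : IsClosed K) (hconv : Convex ℝ K)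
    (hint : (interior K).Nonempty) (hsymm : IsCentrallySymmetric K) (hfree : IsLatticeFree K) :
    latticeWidth K ≤ 2 := by
  obtain ⟨c, hc⟩ := hsymm
  by_contra! hlt
  set f : Plane ≃ₜ Plane := Homeomorph.addRight c with hf
  have hmem : ∀ x, x ∈ f ⁻¹' K ↔ x + c ∈ K := fun x => Iff.rfl
  obtain ⟨z, hz, hpz⟩ := exists_intLattice_sub_mem_interior (K := f ⁻¹' K)
    (hclosed.preimage f.continuous)
    (by
      intro x hx y hy a b ha hb hab
      rw [hmem] at *
      convert hconv hx hy ha hb hab using 1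
      have : c = (a + b) • c := by rw [hab, one_smul]
      nth_rewrite 1 [this]
      module)
    (by
      intro x hx
      rw [hmem] at *
      convert hc _ hx using 1
      module)
    (by
      rw [← f.preimage_interior, Set.mem_preimage]
      simpa [hf] using center_mem_interior hconv hint hc)
    (by
      intro u hu
      by_contra! hcon
      have hle : ∀ x ∈ K, (inner ℝ u x : ℝ) ≤ inner ℝ u c + 1 := by
        intro x hx
        have := hcon (x - c) (by rw [hmem, sub_add_cancel]; exact hx)
        rw [inner_sub_right] at this
        linarith
      have hge : ∀ x ∈ K, (inner ℝ (-u) x : ℝ) ≤ -inner ℝ u c + 1 := by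
        intro x hx
        have := hle _ (hc x hx)
        rw [inner_sub_right, inner_smul_right] at this
        rw [inner_neg_left]
        linarith
      have h₁ : widthFun K u ≤
          ((inner ℝ u c + 1 : ℝ) : EReal) + ((-inner ℝ u c + 1 : ℝ) : EReal) :=
        add_le_add (iSup₂_le fun x hx => EReal.coe_le_coe_iff.2 (hle x hx))
          (iSup₂_le fun x hx => EReal.coe_le_coe_iff.2 (hge x hx))
      rw [← EReal.coe_add] at h₁
      have h₂ : (inner ℝ u c + 1 : ℝ) + (-inner ℝ u c + 1) = 2 := by ring
      rw [h₂] at h₁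
      -- Covering the point `-c` by translates of the interior of `K - c` yields an integer point in
      -- the interior of `K`.
      exact absurd (hlt.trans_le ((iInf₂_le u hu).trans h₁)) (lt_irrefl _)) (-c)
  rw [← f.preimage_interior, Set.mem_preimage] at hpz
  have hfz : f (-c - z) = -z := by
    change -c - z + c = -z
    abel
  rw [hfz] at hpz
  refine Set.disjoint_left.1 hfree hpz fun i => ?_
  obtain ⟨n, hn⟩ := hz i
  exact ⟨-n, by simp [hn]⟩

theorem mainTheorem3 (K : Set Plane) (hclosed : IsClosed K) (hconv : Convex ℝ K)
    (hint : (interior K).Nonempty) (hsymm : IsCentrallySymmetric K) :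
    coveringMinimum 2 K ≤ 2 * coveringMinimum 1 K ∧
      (IsLatticeFree K → latticeWidth K ≤ 2) :=
  ⟨coveringMinimum_two_le hclosed hconv hint hsymm,
    latticeWidth_le_two hclosed hconv hint hsymm⟩
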